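/- **Setting.** Let $(X_k,d_{X_k})_{k\ge 0}$ and $(Y_k,d_{Y_k})_{k\ge 0}$ be sequences of compact metric spaces, let $T_k:X_k\to X_{k+1}$ and $R_k:Y_k\to Y_{k+1}$ be continuous maps, and let $f_k:X_k\to\mathbb R$, $g_k:Y_k\to\mathbb R$ be continuous functions. Write $\boldsymbol T=(T_k)_{k\ge0}$, $\boldsymbol R=(R_k)_{k\ge0}$, $\boldsymbol f=(f_k)_{k\ge0}$, $\boldsymbol g=(g_k)_{k\ge0}$. The potential $\boldsymbol f$ is *equicontinuous* if for every $\varepsilon>0$ there is $\delta>0$ such that $|f_k(x)-f_k(x')|<\varepsilon$ for all $k\ge 0$ and all $x,x'\in X_k$ with $d_{X_k}(x,x')<\delta$; similarly for $\boldsymbol g$. Put $\boldsymbol T^0=\mathrm{id}$, $\boldsymbol T^j=T_{j-1}\circ\cdots\circ T_0$, $S_n\boldsymbol f=\sum_{j=0}^{n-1}f_j\circ \boldsymbol T^j$, and for $n\ge1$, $x\in X_0$, $\varepsilon>0$ let $B_n(x,\varepsilon)$ and $\overline B_n(x,\varepsilon)$ be the open and the closed ball of radius $\varepsilon$ about $x$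 for the metric $d_n(x,y)=\max_{0\le j\le n-1}d_{X_j}(\boldsymbol T^jx,\boldsymbol T^jy)$ on $X_0$. **Bowen pressure.** For $Z\subset X_0$, $s\in\mathbb R$, $\varepsilon>0$ and $N\ge1$ let $$\mathcal M^s_{N,\varepsilon}(Z)=\inf\sum_i\exp\big(-n_is+S_{n_i}\boldsymbol f(x_i)\big),$$ the infimum being over all at most countable families of pairs $(x_i,n_i)$ with $x_i\in X_0$, $n_i\ge N$ and $Z\subset\bigcup_iB_{n_i}(x_i,\varepsilon)$. Let $\mathcal M^s_\varepsilon(Z)=\lim_{N\to\infty}\mathcal M^s_{N,\varepsilon}(Z)$ and $$P^B(\boldsymbol T,\boldsymbol f,Z)=\lim_{\varepsilon\to0}\,\inf\{s\in\mathbb R:\mathcal M^s_\varepsilon(Z)=0\}.$$ **Packing pressure.** Let $$\mathcal P^s_{N,\varepsilon}(Z)=\sup\sum_i\exp\big(-n_is+S_{n_i}\boldsymbol f(x_i)\big),$$ the supremum being over all at most countable families of pairs $(x_i,n_i)$ with $x_i\in Z$, $n_i\ge N$ and the balls $\overline B_{n_i}(x_i,\varepsilon)$ pairwise disjoint. Let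 $\mathcal P^s_{\infty,\varepsilon}(Z)=\lim_{N\to\infty}\mathcal P^s_{N,\varepsilon}(Z)$, $\mathcal P^s_\varepsilon(Z)=\inf\big\{\sum_{i=1}^\infty\mathcal P^s_{\infty,\varepsilon}(Z_i):Z\subset\bigcup_{i=1}^\infty Z_i\big\}$ and $$P^P(\boldsymbol T,\boldsymbol f,Z)=\lim_{\varepsilon\to0}\,\inf\{s\in\mathbb R:\mathcal P^s_\varepsilon(Z)=0\}.$$ Both pressures are extended real numbers, with $\inf\emptyset=+\infty$ and $\inf\mathbb R=-\infty$. Both limits as $\varepsilon\to0$ exist by monotonicity in $\varepsilon$. **Product.** Give $X_k\times Y_k$ the maximum metric, and let $\boldsymbol T\times\boldsymbol R$ be the system of the maps $(x,y)\mapsto(T_kx,R_ky)$ and $\boldsymbol f\dotplus\boldsymbol g$ the potential of the functions $(x,y)\mapsto f_k(x)+g_k(y)$. **Theorem.** Let $\boldsymbol f$ and $\boldsymbol g$ be equicontinuous, and let $Z\subset X_0$ and $W\subset Y_0$ be arbitrary subsets. Then $$P^B(\boldsymbol T,\boldsymbol f,Z)+P^P(\boldsymbol R,\boldsymbol g,W)\le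 P^P(\boldsymbol T\times\boldsymbol R,\boldsymbol f\dotplus\boldsymbol g,Z\times W)\le P^P(\boldsymbol T,\boldsymbol f,Z)+P^P(\boldsymbol R,\boldsymbol g,W),$$ where each of the two inequalities is asserted whenever the sum of two pressures in it is not of the form $\infty-\infty$. -/

import Mathlib

open scoped ENNReal

/-!
Nonautonomous dynamical systems: a sequence of compact metric spaces `X k` and a sequence of
continuous maps `T k : C(X k, X (k + 1))`. A potential is a sequence `f k : C(X k, ℝ)`.
-/

namespace NDS

section System

variable {X : ℕ → Type*} [∀ k, MetricSpace (X k)]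

/-- The composition `T (j - 1) ∘ ⋯ ∘ T 0 : X 0 → X j` (the identity for `j = 0`). -/
def orbit (T : ∀ k, C(X k, X (k + 1))) : (j : ℕ) → X 0 → X j
  | 0, x => x
  | j + 1, x => T j (orbit T j x)

/-- The ergodic sum `∑ j < n, f j (T^j x)`. -/
noncomputable def ergSum (T : ∀ k, C(X k, X (k + 1))) (f : ∀ k, C(X k, ℝ)) (n : ℕ) (x : X 0) : ℝ :=
  ∑ j ∈ Finset.range n, f j (orbit T j x)

/-- The open Bowen ball: the points `y` with `dist (T^j x) (T^j y) < ε` for all `0 ≤ j ≤ n - 1`. -/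
def bowenBall (T : ∀ k, C(X k, X (k + 1))) (n : ℕ) (x : X 0) (ε : ℝ) : Set (X 0) :=
  {y | ∀ j < n, orbit T j y ∈ Metric.ball (orbit T j x) ε}

/-- The closed Bowen ball: the points `y` with `dist (T^j x) (T^j y) ≤ ε` for all
`0 ≤ j ≤ n - 1`. -/
def closedBowenBall (T : ∀ k, C(X k, X (k + 1))) (n : ℕ) (x : X 0) (ε : ℝ) : Set (X 0) :=
  {y | ∀ j < n, orbit T j y ∈ Metric.closedBall (orbit T j x) ε}

/-- Equicontinuity of a potential, uniformly over all the levels `k`. -/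
def EquicontinuousPotential (f : ∀ k, C(X k, ℝ)) : Prop :=
  ∀ ε > 0, ∃ δ > 0, ∀ (k : ℕ) (x y : X k), dist x y < δ → |f k x - f k y| < ε

/-- The term `exp (-n s + S_n f (x))` attached to a ball with centre `x = p.1` and length
`n = p.2`. -/
noncomputable def weight (T : ∀ k, C(X k, X (k + 1))) (f : ∀ k, C(X k, ℝ)) (s : ℝ)
    (p : X 0 × ℕ) : ℝ≥0∞ :=
  ENNReal.ofReal (Real.exp (-(p.2 : ℝ) * s + ergSum T f p.2 p.1))

/-- A countable `(N, ε)`-cover of `Z` by open Bowen balls, given by the set `C` of the pairs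
(centre, length) of its balls. -/
structure IsCover (T : ∀ k, C(X k, X (k + 1))) (Z : Set (X 0)) (N : ℕ) (ε : ℝ)
    (C : Set (X 0 × ℕ)) : Prop where
  countable : C.Countable
  le_length : ∀ p ∈ C, N ≤ p.2
  subset_iUnion : Z ⊆ ⋃ p ∈ C, bowenBall T p.2 p.1 ε

/-- A countable `(N, ε)`-packing of `Z` by pairwise disjoint closed Bowen balls with centres in
`Z`, given by the set `C` of the pairs (centre, length) of its balls. -/
structure IsPacking (T : ∀ k, C(X k, X (k + 1))) (Z : Set (X 0)) (N : ℕ) (ε : ℝ)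
    (C : Set (X 0 × ℕ)) : Prop where
  countable : C.Countable
  centre_mem : ∀ p ∈ C, p.1 ∈ Z
  le_length : ∀ p ∈ C, N ≤ p.2
  disjoint : C.PairwiseDisjoint fun p => closedBowenBall T p.2 p.1 ε

/-- The infimum of `∑ exp (-n_i s + S_{n_i} f (x_i))` over the countable `(N, ε)`-covers. -/
noncomputable def bowenPre (T : ∀ k, C(X k, X (k + 1))) (f : ∀ k, C(X k, ℝ)) (s ε : ℝ) (N : ℕ)
    (Z : Set (X 0)) : ℝ≥0∞ :=
  ⨅ (C : Set (X 0 × ℕ)) (_ : IsCover T Z N ε C), ∑' p : C, weight T f s p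

/-- The limit of `bowenPre` as `N → ∞`; it is nondecreasing in `N`, so this is a supremum. -/
noncomputable def bowenMeasure (T : ∀ k, C(X k, X (k + 1))) (f : ∀ k, C(X k, ℝ)) (s ε : ℝ)
    (Z : Set (X 0)) : ℝ≥0∞ :=
  ⨆ (N : ℕ) (_ : 0 < N), bowenPre T f s ε N Z

/-- The critical value of `s` at scale `ε`, an extended real (`inf ∅ = +∞`). -/
noncomputable def bowenPressureAt (T : ∀ k, C(X k, X (k + 1))) (f : ∀ k, C(X k, ℝ))
    (Z : Set (X 0)) (ε : ℝ) : EReal :=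
  ⨅ (s : ℝ) (_ : bowenMeasure T f s ε Z = 0), (s : EReal)

/-- The Bowen (Bowen-Pesin-Pitskel') pressure: the limit of `bowenPressureAt` as `ε → 0`. It is
nonincreasing in `ε`, so this is the supremum over `ε > 0`. -/
noncomputable def bowenPressure (T : ∀ k, C(X k, X (k + 1))) (f : ∀ k, C(X k, ℝ))
    (Z : Set (X 0)) : EReal :=
  ⨆ (ε : ℝ) (_ : 0 < ε), bowenPressureAt T f Z ε

/-- The supremum of `∑ exp (-n_i s + S_{n_i} f (x_i))` over the countable `(N, ε)`-packings. -/
noncomputable def packingPre (T : ∀ k, C(X k, X (k + 1))) (f : ∀ k, C(X k, ℝ)) (s ε : ℝ) (N : ℕ)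
    (Z : Set (X 0)) : ℝ≥0∞ :=
  ⨆ (C : Set (X 0 × ℕ)) (_ : IsPacking T Z N ε C), ∑' p : C, weight T f s p

/-- The limit of `packingPre` as `N → ∞`; it is nonincreasing in `N`, so this is an infimum. -/
noncomputable def packingPreLim (T : ∀ k, C(X k, X (k + 1))) (f : ∀ k, C(X k, ℝ)) (s ε : ℝ)
    (Z : Set (X 0)) : ℝ≥0∞ :=
  ⨅ (N : ℕ) (_ : 0 < N), packingPre T f s ε N Z

/-- The packing measure: the infimum of `∑ packingPreLim (Z_i)` over the countable families of
sets `Z_i` that cover `Z`. -/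
noncomputable def packingMeasure (T : ∀ k, C(X k, X (k + 1))) (f : ∀ k, C(X k, ℝ)) (s ε : ℝ)
    (Z : Set (X 0)) : ℝ≥0∞ :=
  ⨅ (A : ℕ → Set (X 0)) (_ : Z ⊆ ⋃ i, A i), ∑' i, packingPreLim T f s ε (A i)

/-- The critical value of `s` at scale `ε`, an extended real (`inf ∅ = +∞`). -/
noncomputable def packingPressureAt (T : ∀ k, C(X k, X (k + 1))) (f : ∀ k, C(X k, ℝ))
    (Z : Set (X 0)) (ε : ℝ) : EReal :=
  ⨅ (s : ℝ) (_ : packingMeasure T f s ε Z = 0), (s : EReal)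

/-- The packing pressure: the limit of `packingPressureAt` as `ε → 0`. It is nonincreasing in
`ε`, so this is the supremum over `ε > 0`. -/
noncomputable def packingPressure (T : ∀ k, C(X k, X (k + 1))) (f : ∀ k, C(X k, ℝ))
    (Z : Set (X 0)) : EReal :=
  ⨆ (ε : ℝ) (_ : 0 < ε), packingPressureAt T f Z ε

end System

section Product

variable {X Y : ℕ → Type*} [∀ k, MetricSpace (X k)] [∀ k, MetricSpace (Y k)]

/-- The product system on `X k × Y k` (with the maximum metric): `(x, y) ↦ (T k x, R k y)`. -/
def prodMaps (T : ∀ k, C(X k, X (k + 1))) (R : ∀ k, C(Y k, Y (k + 1))) (k : ℕ) :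
    C(X k × Y k, X (k + 1) × Y (k + 1)) :=
  (T k).prodMap (R k)

/-- The potential `(x, y) ↦ f k x + g k y` on the product. -/
def sumPotential (f : ∀ k, C(X k, ℝ)) (g : ∀ k, C(Y k, ℝ)) (k : ℕ) : C(X k × Y k, ℝ) :=
  ⟨fun p => f k p.1 + g k p.2, by fun_prop⟩

end Product

/-- The sum `a + b` of extended reals is not of the form `∞ - ∞`. -/
def SumDefined (a b : EReal) : Prop :=
  ¬ (a = ⊤ ∧ b = ⊥) ∧ ¬ (a = ⊥ ∧ b = ⊤)

end NDS

/-!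
Both inequalities rest on replacing packings and covers of arbitrary lengths by ones of a single
length `n`. In any set `A`, a maximal family of centres whose closed Bowen balls of length `n` and
radius `ε` are disjoint is countable and `2 ε`-dense in `A` for the metric `d_n`
(`NDS.exists_maximal_packing`), so it is both a packing of `A` and the set of centres of a cover.

*Upper bound.* In a packing of `A ×ˢ B` at scale `ε`, consider the balls of length `n`. Sending each
centre to a nearby pair from `E × F`, where `E` and `F` are maximal packings of `A` and `B` at scale
`ε / 2`, is injective, since two centres sent to the same pair would have intersecting balls. By
equicontinuity the weights change by at most a factor `exp (2 n η)`, so the sum over the balls of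
length `n` is at most the product of the packing sums of `A` and `B`
(`NDS.tsum_weight_prod_le_of_length_eq`). Increasing the exponent by `η` makes the sum over `n`
converge (`NDS.packingPreLim_prod_ne_top`), and increasing it again makes the limit vanish.

*Lower bound.* Let `Z ×ˢ W` be covered by sets `E i` with finite packing premeasure for the exponent
`s + t`. If the Bowen measure of `Z` for `s` is not zero, then by countable subadditivity every
`y ∈ W` has a slice `{x | (x, y) ∈ E i}` of positive Bowen measure. Group the points `y` according
to `i`, to a lower bound `1 / (k + 1)` for this measure and to the length from which on it holds.
Over each ball of a packing of such a group of points, place a maximal packing of the slice with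
balls of the same length as the given ball: the weights of the slice sum to at least `1 / (k + 1)`,
because the enlarged balls cover it, and together these balls form a packing of `E i`
(`NDS.mul_packingPre_le`). So each group has finite packing premeasure for `t`, and zero premeasure
for every larger exponent (`NDS.packingMeasure_eq_zero_of_prod`).
-/

namespace NDS

section System

variable {X : ℕ → Type*} [∀ k, MetricSpace (X k)]
  {T : ∀ k, C(X k, X (k + 1))} {f : ∀ k, C(X k, ℝ)}

/-! ### Bowen balls and weights -/

lemma continuous_orbit (T : ∀ k, C(X k, X (k + 1))) (j : ℕ) : Continuous (orbit T j) := by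
  induction j with
  | zero => exact continuous_id
  | succ j ih => exact (T j).continuous.comp ih

lemma isOpen_bowenBall (n : ℕ) (x : X 0) (ε : ℝ) : IsOpen (bowenBall T n x ε) := by
  have : bowenBall T n x ε =
      ⋂ j ∈ Finset.range n, orbit T j ⁻¹' Metric.ball (orbit T j x) ε := by
    ext y
    simp [bowenBall]
  rw [this]
  exact isOpen_biInter_finset fun j _ => Metric.isOpen_ball.preimage (continuous_orbit T j)

lemma mem_bowenBall_self {n : ℕ} {x : X 0} {ε : ℝ} (hε : 0 < ε) : x ∈ bowenBall T n x ε :=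
  fun _ _ => Metric.mem_ball_self hε

lemma bowenBall_subset_closedBowenBall (n : ℕ) (x : X 0) (ε : ℝ) :
    bowenBall T n x ε ⊆ closedBowenBall T n x ε :=
  fun _ hy j hj => Metric.ball_subset_closedBall (hy j hj)

lemma mem_closedBowenBall_self {n : ℕ} {x : X 0} {ε : ℝ} (hε : 0 < ε) :
    x ∈ closedBowenBall T n x ε :=
  bowenBall_subset_closedBowenBall n x ε (mem_bowenBall_self hε)

lemma bowenBall_mono {n : ℕ} {x : X 0} {ε ε' : ℝ} (h : ε ≤ ε') :
    bowenBall T n x ε ⊆ bowenBall T n x ε' :=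
  fun _ hy j hj => Metric.ball_subset_ball h (hy j hj)

lemma closedBowenBall_mono {n : ℕ} {x : X 0} {ε ε' : ℝ} (h : ε ≤ ε') :
    closedBowenBall T n x ε ⊆ closedBowenBall T n x ε' :=
  fun _ hy j hj => Metric.closedBall_subset_closedBall h (hy j hj)

lemma weight_add (s η : ℝ) (p : X 0 × ℕ) :
    weight T f (s + η) p = ENNReal.ofReal (Real.exp (-(p.2 : ℝ) * η)) * weight T f s p := by
  rw [weight, weight, ← ENNReal.ofReal_mul (Real.exp_nonneg _), ← Real.exp_add]
  congr 2
  ring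

lemma weight_anti {s s' : ℝ} (h : s ≤ s') (p : X 0 × ℕ) : weight T f s' p ≤ weight T f s p := by
  refine ENNReal.ofReal_le_ofReal (Real.exp_le_exp.2 ?_)
  have := mul_le_mul_of_nonneg_left h (Nat.cast_nonneg (α := ℝ) p.2)
  linarith

/-- Moving the centre of a ball of length `n` by less than a modulus of equicontinuity for `η`
costs a factor of at most `exp (n η)`. -/
lemma weight_add_le_of_dist_lt {η δ : ℝ}
    (hδ : ∀ (k : ℕ) (x y : X k), dist x y < δ → |f k x - f k y| < η) {n : ℕ} {x e : X 0}
    (h : ∀ j < n, dist (orbit T j x) (orbit T j e) < δ) (s : ℝ) :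
    weight T f (s + η) (x, n) ≤ weight T f s (e, n) := by
  refine ENNReal.ofReal_le_ofReal (Real.exp_le_exp.2 ?_)
  have : ergSum T f n x ≤ ergSum T f n e + n * η := by
    have h2 : ∀ j ∈ Finset.range n, f j (orbit T j x) ≤ f j (orbit T j e) + η := fun j hj => by
      have := (abs_lt.1 (hδ j _ _ (h j (Finset.mem_range.1 hj)))).2
      linarith
    have h3 := Finset.sum_le_sum h2
    rw [Finset.sum_add_distrib, Finset.sum_const, Finset.card_range, nsmul_eq_mul] at h3
    exact h3
  simp only
  linarith

/-- A maximal family of centres in `A` whose closed balls of length `n` and radius `ε` are disjoint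
is `2 ε`-dense in `A`. -/
lemma exists_maximal_packing [CompactSpace (X 0)] (T : ∀ k, C(X k, X (k + 1))) (A : Set (X 0))
    (n : ℕ) {ε : ℝ} (hε : 0 < ε) :
    ∃ E ⊆ A, E.Countable ∧ E.PairwiseDisjoint (fun x => closedBowenBall T n x ε) ∧
      ∀ x ∈ A, ∃ e ∈ E, ∀ j < n, dist (orbit T j x) (orbit T j e) ≤ 2 * ε := by
  obtain ⟨E, hEA, hE, hd⟩ := Vitali.exists_disjoint_subfamily_covering_enlargement
    (fun x => closedBowenBall T n x ε) A (fun _ => 1) 2 one_lt_two (fun _ _ => zero_le_one) 1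
    (fun _ _ => le_rfl) (fun x _ => ⟨x, mem_closedBowenBall_self hε⟩)
  refine ⟨E, hEA, hE.countable_of_nonempty_interior fun x _ => ⟨x, ?_⟩, hE, fun x hx => ?_⟩
  · exact interior_maximal (bowenBall_subset_closedBowenBall n x ε) (isOpen_bowenBall n x ε)
      (mem_bowenBall_self hε)
  · obtain ⟨e, he, ⟨z, hzx, hze⟩, -⟩ := hd x hx
    refine ⟨e, he, fun j hj => ?_⟩
    have h1 := Metric.mem_closedBall'.1 (hzx j hj)
    have h2 := Metric.mem_closedBall.1 (hze j hj)
    linarith [dist_triangle (orbit T j x) (orbit T j z) (orbit T j e)]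

/-- Packings of a single length, given by the set of their centres. -/
lemma tsum_weight_le_packingPre {A E : Set (X 0)} (hEA : E ⊆ A) (hc : E.Countable) {n N : ℕ}
    (hN : N ≤ n) {ε : ℝ} (hE : E.PairwiseDisjoint (fun x => closedBowenBall T n x ε)) (s : ℝ) :
    ∑' x : E, weight T f s (x, n) ≤ packingPre T f s ε N A := by
  have hinj : Function.Injective (fun x : X 0 => (x, n)) := fun x y h => (Prod.ext_iff.1 h).1
  have hp : IsPacking T A N ε ((fun x => (x, n)) '' E) := by
    refine ⟨hc.image _, ?_, ?_, ?_⟩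
    · rintro _ ⟨x, hx, rfl⟩
      exact hEA hx
    · rintro _ ⟨x, hx, rfl⟩
      exact hN
    · rintro _ ⟨x, hx, rfl⟩ _ ⟨y, hy, rfl⟩ hxy
      exact hE hx hy fun h => hxy (by rw [h])
  rw [packingPre]
  refine le_iSup₂_of_le _ hp ?_
  rw [tsum_image (fun p => weight T f s p) hinj.injOn]

/-! ### The packing measure -/

lemma packingPre_mono {s s' ε ε' : ℝ} {N N' : ℕ} {A : Set (X 0)}
    (hs : s ≤ s') (hε : ε ≤ ε') (hN : N ≤ N') :
    packingPre T f s' ε' N' A ≤ packingPre T f s ε N A := by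
  refine iSup₂_le fun C hC => le_iSup₂_of_le C ⟨hC.countable, hC.centre_mem,
    fun p hp => hN.trans (hC.le_length p hp), ?_⟩ (ENNReal.tsum_le_tsum fun p => weight_anti hs _)
  exact hC.disjoint.mono fun p => closedBowenBall_mono hε

lemma packingMeasure_mono {s s' ε ε' : ℝ} {A : Set (X 0)} (hs : s ≤ s') (hε : ε ≤ ε') :
    packingMeasure T f s' ε' A ≤ packingMeasure T f s ε A :=
  iInf₂_mono fun _ _ => ENNReal.tsum_le_tsum fun _ => iInf₂_mono fun _ _ =>
    packingPre_mono hs hε le_rfl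

lemma exists_packingPre_ne_top {s ε : ℝ} {A : Set (X 0)} (h : packingPreLim T f s ε A ≠ ⊤) :
    ∃ N, 0 < N ∧ packingPre T f s ε N A ≠ ⊤ := by
  by_contra! hc
  exact h (by simpa [packingPreLim] using hc)

lemma packingPreLim_ne_top {s ε : ℝ} {A : Set (X 0)} {N : ℕ} (hN : 0 < N)
    (h : packingPre T f s ε N A ≠ ⊤) : packingPreLim T f s ε A ≠ ⊤ :=
  ((iInf₂_le N hN).trans_lt h.lt_top).ne

lemma packingPreLim_eq_zero {s η ε : ℝ} (hη : 0 < η) {A : Set (X 0)}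
    (h : packingPreLim T f s ε A ≠ ⊤) : packingPreLim T f (s + η) ε A = 0 := by
  obtain ⟨N₀, hN₀, hfin⟩ := exists_packingPre_ne_top h
  have key : ∀ N, N₀ ≤ N → packingPreLim T f (s + η) ε A ≤
      ENNReal.ofReal (Real.exp (-(N : ℝ) * η)) * packingPre T f s ε N₀ A := by
    intro N hN
    refine (iInf₂_le N (hN₀.trans_le hN)).trans (iSup₂_le fun C hC => ?_)
    calc ∑' p : C, weight T f (s + η) p
        ≤ ∑' p : C, ENNReal.ofReal (Real.exp (-(N : ℝ) * η)) * weight T f s p := by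
          refine ENNReal.tsum_le_tsum fun p => ?_
          rw [weight_add]
          gcongr
          exact hC.le_length p p.2
      _ = ENNReal.ofReal (Real.exp (-(N : ℝ) * η)) * ∑' p : C, weight T f s p :=
          ENNReal.tsum_mul_left
      _ ≤ _ := by
          gcongr
          rw [packingPre]
          exact le_iSup₂_of_le C ⟨hC.countable, hC.centre_mem,
            fun p hp => hN.trans (hC.le_length p hp), hC.disjoint⟩ le_rfl
  have hlim : Filter.Tendsto (fun N : ℕ => ENNReal.ofReal (Real.exp (-(N : ℝ) * η)) *
      packingPre T f s ε N₀ A) Filter.atTop (nhds 0) := by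
    have h1 : Filter.Tendsto (fun N : ℕ => Real.exp (-(N : ℝ) * η)) Filter.atTop (nhds 0) := by
      refine Real.tendsto_exp_atBot.comp ?_
      simp only [neg_mul]
      exact Filter.tendsto_neg_atTop_atBot.comp
        (tendsto_natCast_atTop_atTop.atTop_mul_const hη)
    have h2 := ENNReal.Tendsto.mul_const (ENNReal.tendsto_ofReal h1)
      (Or.inr hfin)
    simpa using h2
  exact le_antisymm (ge_of_tendsto hlim (Filter.eventually_atTop.2 ⟨N₀, key⟩)) (zero_le)

lemma packingMeasure_eq_zero {ι : Type*} [Countable ι] [Nonempty ι] {s ε : ℝ} {A : Set (X 0)}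
    (B : ι → Set (X 0)) (hA : A ⊆ ⋃ i, B i) (h : ∀ i, packingPreLim T f s ε (B i) = 0) :
    packingMeasure T f s ε A = 0 := by
  obtain ⟨e, he⟩ := exists_surjective_nat ι
  refine le_antisymm ((iInf₂_le (fun n => B (e n)) ?_).trans ?_) zero_le
  · rwa [he.iUnion_comp B]
  · simp [h]

lemma exists_cover_packingPreLim_ne_top {s ε : ℝ} {A : Set (X 0)}
    (h : packingMeasure T f s ε A = 0) :
    ∃ B : ℕ → Set (X 0), A ⊆ ⋃ i, B i ∧ ∀ i, packingPreLim T f s ε (B i) ≠ ⊤ := by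
  have h1 : packingMeasure T f s ε A < ⊤ := by simp [h]
  obtain ⟨B, hB, hlt⟩ := by simpa only [packingMeasure, iInf_lt_iff] using h1
  exact ⟨B, hB, fun i => ((ENNReal.le_tsum i).trans_lt hlt).ne⟩

lemma packingMeasure_eq_zero_of_pressure_lt {s ε : ℝ} {A : Set (X 0)} (hε : 0 < ε)
    (h : packingPressure T f A < s) : packingMeasure T f s ε A = 0 := by
  have h1 : packingPressureAt T f A ε < s :=
    (le_iSup₂ (f := fun (ε : ℝ) (_ : 0 < ε) => packingPressureAt T f A ε) ε hε).trans_lt h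
  obtain ⟨s', h0, hlt⟩ := by simpa only [packingPressureAt, iInf_lt_iff] using h1
  exact le_antisymm ((packingMeasure_mono (EReal.coe_lt_coe_iff.1 hlt).le le_rfl).trans h0.le)
    zero_le

lemma exists_packingMeasure_ne_zero {s : ℝ} {A : Set (X 0)} (h : s < packingPressure T f A) :
    ∃ ε > 0, packingMeasure T f s ε A ≠ 0 := by
  obtain ⟨ε, hε, hlt⟩ := by simpa only [packingPressure, lt_iSup_iff] using h
  exact ⟨ε, hε, fun h0 => hlt.not_ge (iInf₂_le s h0)⟩

/-! ### The Bowen measure -/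

lemma bowenPre_le_tsum {A E : Set (X 0)} (hc : E.Countable) {n N : ℕ} (hN : N ≤ n) {ε : ℝ}
    (hE : ∀ x ∈ A, ∃ e ∈ E, x ∈ bowenBall T n e ε) (s : ℝ) :
    bowenPre T f s ε N A ≤ ∑' x : E, weight T f s (x, n) := by
  have hinj : Function.Injective (fun x : X 0 => (x, n)) := fun x y h => (Prod.ext_iff.1 h).1
  have hp : IsCover T A N ε ((fun x => (x, n)) '' E) := by
    refine ⟨hc.image _, ?_, fun x hx => ?_⟩
    · rintro _ ⟨x, hx, rfl⟩
      exact hN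
    · obtain ⟨e, he, hxe⟩ := hE x hx
      exact Set.mem_biUnion (Set.mem_image_of_mem _ he) hxe
  refine (iInf₂_le _ hp).trans ?_
  rw [tsum_image (fun p => weight T f s p) hinj.injOn]

lemma bowenMeasure_anti {s ε ε' : ℝ} {A : Set (X 0)} (hε : ε ≤ ε') :
    bowenMeasure T f s ε' A ≤ bowenMeasure T f s ε A := by
  refine iSup₂_mono fun N _ => le_iInf₂ fun C hC => iInf₂_le C ⟨hC.countable, hC.le_length, ?_⟩
  exact hC.subset_iUnion.trans (Set.iUnion₂_mono fun p _ => bowenBall_mono hε)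

/-- The null sets of the Bowen measure are closed under countable unions. -/
lemma bowenMeasure_eq_zero_of_subset_iUnion {s ε : ℝ} {A : Set (X 0)} {B : ℕ → Set (X 0)}
    (hA : A ⊆ ⋃ i, B i) (h : ∀ i, bowenMeasure T f s ε (B i) = 0) :
    bowenMeasure T f s ε A = 0 := by
  simp only [bowenMeasure, ENNReal.iSup_eq_zero] at h ⊢
  intro N hN
  refine le_antisymm (ENNReal.le_of_forall_pos_le_add fun θ hθ _ => ?_) zero_le
  obtain ⟨r, hr, hsum⟩ := ENNReal.exists_pos_sum_of_countable'
    (ENNReal.coe_pos.2 hθ).ne' ℕ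
  have hC : ∀ i, ∃ C, IsCover T (B i) N ε C ∧ ∑' p : C, weight T f s p < r i := by
    intro i
    have h1 : bowenPre T f s ε N (B i) < r i := by
      rw [h i N hN]
      exact hr i
    simpa only [bowenPre, iInf_lt_iff, exists_prop] using h1
  choose C hC hlt using hC
  rw [zero_add]
  have hcover : IsCover T A N ε (⋃ i, C i) := by
    refine ⟨Set.countable_iUnion fun i => (hC i).countable, fun p hp => ?_, fun x hx => ?_⟩
    · obtain ⟨i, hi⟩ := Set.mem_iUnion.1 hp
      exact (hC i).le_length p hi
    · obtain ⟨i, hi⟩ := Set.mem_iUnion.1 (hA hx)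
      obtain ⟨p, hp, hxp⟩ := Set.mem_iUnion₂.1 ((hC i).subset_iUnion hi)
      exact Set.mem_biUnion (Set.mem_iUnion.2 ⟨i, hp⟩) hxp
  exact (iInf₂_le _ hcover).trans
    ((ENNReal.tsum_iUnion_le_tsum (fun p => weight T f s p) C).trans <|
      (ENNReal.tsum_le_tsum fun i => (hlt i).le).trans hsum.le)

lemma exists_bowenMeasure_ne_zero {s : ℝ} {A : Set (X 0)} (h : s < bowenPressure T f A) :
    ∃ ε > 0, bowenMeasure T f s ε A ≠ 0 := by
  obtain ⟨ε, hε, hlt⟩ := by simpa only [bowenPressure, lt_iSup_iff] using h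
  exact ⟨ε, hε, fun h0 => hlt.not_ge (iInf₂_le s h0)⟩

end System

section Product

/-! ### The product system -/

variable {X Y : ℕ → Type*} [∀ k, MetricSpace (X k)] [∀ k, MetricSpace (Y k)]
  {T : ∀ k, C(X k, X (k + 1))} {R : ∀ k, C(Y k, Y (k + 1))}
  {f : ∀ k, C(X k, ℝ)} {g : ∀ k, C(Y k, ℝ)}

lemma orbit_prodMaps (j : ℕ) (x : X 0) (y : Y 0) :
    orbit (X := fun k => X k × Y k) (prodMaps T R) j (x, y) = (orbit T j x, orbit R j y) := by
  induction j with
  | zero => rfl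
  | succ j ih =>
    change prodMaps T R j (orbit (X := fun k => X k × Y k) (prodMaps T R) j (x, y)) = _
    rw [ih]
    rfl

lemma closedBowenBall_prodMaps (n : ℕ) (p : X 0 × Y 0) (ε : ℝ) :
    closedBowenBall (X := fun k => X k × Y k) (prodMaps T R) n p ε =
      closedBowenBall T n p.1 ε ×ˢ closedBowenBall R n p.2 ε := by
  obtain ⟨x, y⟩ := p
  ext ⟨x', y'⟩
  simp only [closedBowenBall, orbit_prodMaps, Metric.mem_closedBall, Prod.dist_eq, sup_le_iff,
    Set.mem_prod, Set.mem_ofPred_eq]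
  exact ⟨fun h => ⟨fun j hj => (h j hj).1, fun j hj => (h j hj).2⟩,
    fun h j hj => ⟨h.1 j hj, h.2 j hj⟩⟩

lemma weight_prodMaps (s t : ℝ) (x : X 0) (y : Y 0) (n : ℕ) :
    weight (X := fun k => X k × Y k) (prodMaps T R) (sumPotential f g) (s + t) ((x, y), n) =
      weight T f s (x, n) * weight R g t (y, n) := by
  rw [weight, weight, weight, ← ENNReal.ofReal_mul (Real.exp_nonneg _), ← Real.exp_add]
  have : ergSum (X := fun k => X k × Y k) (prodMaps T R) (sumPotential f g) n (x, y) =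
      ergSum T f n x + ergSum R g n y := by
    simp only [ergSum, orbit_prodMaps, ← Finset.sum_add_distrib]
    rfl
  simp only [this]
  congr 2
  ring

/-! ### The upper bound -/

/-- The sum over the balls of a single length in a packing of a product. -/
lemma tsum_weight_prod_le_of_length_eq [CompactSpace (X 0)] [CompactSpace (Y 0)] {η δ ε : ℝ}
    (hf : ∀ (k : ℕ) (x y : X k), dist x y < δ → |f k x - f k y| < η)
    (hg : ∀ (k : ℕ) (x y : Y k), dist x y < δ → |g k x - g k y| < η)
    (hε : 0 < ε) (hεδ : ε < δ) {A : Set (X 0)} {B : Set (Y 0)} {N n : ℕ} (hN : N ≤ n)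
    {C : Set ((X 0 × Y 0) × ℕ)}
    (hC : IsPacking (X := fun k => X k × Y k) (prodMaps T R) (A ×ˢ B) N ε C)
    (hn : ∀ p ∈ C, p.2 = n) (s t : ℝ) :
    ∑' p : C, weight (X := fun k => X k × Y k) (prodMaps T R) (sumPotential f g)
        ((s + η) + (t + η)) p ≤
      packingPre T f s (ε / 2) N A * packingPre R g t (ε / 2) N B := by
  obtain ⟨E, hEA, hEc, hEd, hE⟩ := exists_maximal_packing T A n (half_pos hε)
  obtain ⟨F, hFB, hFc, hFd, hF⟩ := exists_maximal_packing R B n (half_pos hε)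
  choose! e heE he using hE
  choose! d hdF hd using hF
  simp only [mul_div_cancel₀ ε (two_ne_zero)] at he hd
  have hA : ∀ p ∈ C, p.1.1 ∈ A := fun p hp => (hC.centre_mem p hp).1
  have hB : ∀ p ∈ C, p.1.2 ∈ B := fun p hp => (hC.centre_mem p hp).2
  let φ : C → E × F := fun p => (⟨e p.1.1.1, heE _ (hA p p.2)⟩, ⟨d p.1.1.2, hdF _ (hB p p.2)⟩)
  have hmem : ∀ p ∈ C, (e p.1.1, d p.1.2) ∈
      closedBowenBall (X := fun k => X k × Y k) (prodMaps T R) p.2 p.1 ε := by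
    intro p hp
    rw [closedBowenBall_prodMaps, hn p hp]
    exact ⟨fun j hj => Metric.mem_closedBall'.2 (he _ (hA p hp) j hj),
      fun j hj => Metric.mem_closedBall'.2 (hd _ (hB p hp) j hj)⟩
  have hφ : Function.Injective φ := by
    rintro ⟨p, hp⟩ ⟨q, hq⟩ hpq
    obtain ⟨h1, h2⟩ := Prod.ext_iff.1 hpq
    replace h1 : e p.1.1 = e q.1.1 := congrArg Subtype.val h1
    replace h2 : d p.1.2 = d q.1.2 := congrArg Subtype.val h2
    by_contra hne
    refine Set.disjoint_left.1 (hC.disjoint hp hq fun h => hne (Subtype.ext h)) (hmem p hp) ?_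
    rw [h1, h2]
    exact hmem q hq
  calc _ ≤ ∑' p : C, weight T f s ((φ p).1, n) * weight R g t ((φ p).2, n) := by
        refine ENNReal.tsum_le_tsum fun p => ?_
        obtain ⟨⟨⟨x, y⟩, m⟩, hp⟩ := p
        obtain rfl : m = n := hn _ hp
        rw [weight_prodMaps]
        exact mul_le_mul'
          (weight_add_le_of_dist_lt hf (fun j hj => (he x (hA _ hp) j hj).trans_lt hεδ) s)
          (weight_add_le_of_dist_lt hg (fun j hj => (hd y (hB _ hp) j hj).trans_lt hεδ) t)
    _ ≤ ∑' q : E × F, weight T f s (q.1, n) * weight R g t (q.2, n) :=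
        ENNReal.tsum_comp_le_tsum_of_injective hφ
          (fun q : E × F => weight T f s (q.1, n) * weight R g t (q.2, n))
    _ = (∑' x : E, weight T f s (x, n)) * ∑' y : F, weight R g t (y, n) := by
        rw [ENNReal.tsum_prod']
        simp only [ENNReal.tsum_mul_left, ENNReal.tsum_mul_right]
    _ ≤ _ := mul_le_mul' (tsum_weight_le_packingPre hEA hEc hN hEd s)
        (tsum_weight_le_packingPre hFB hFc hN hFd t)

lemma tsum_ofReal_exp_neg_mul_ne_top {η : ℝ} (hη : 0 < η) :
    ∑' n : ℕ, ENNReal.ofReal (Real.exp (-(n : ℝ) * η)) ≠ ⊤ := by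
  have h : Summable fun n : ℕ => Real.exp (-(n : ℝ) * η) := by
    have := Real.summable_exp_nat_mul_iff.2 (neg_lt_zero.2 hη)
    refine this.congr fun n => ?_
    congr 1
    ring
  rw [← ENNReal.ofReal_tsum_of_nonneg (fun n => Real.exp_nonneg _) h]
  exact ENNReal.ofReal_ne_top

lemma packingPreLim_prod_ne_top [CompactSpace (X 0)] [CompactSpace (Y 0)] {η δ ε : ℝ}
    (hη : 0 < η)
    (hf : ∀ (k : ℕ) (x y : X k), dist x y < δ → |f k x - f k y| < η)
    (hg : ∀ (k : ℕ) (x y : Y k), dist x y < δ → |g k x - g k y| < η)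
    (hε : 0 < ε) (hεδ : ε < δ) {A : Set (X 0)} {B : Set (Y 0)} {s t : ℝ}
    (hA : packingPreLim T f s (ε / 2) A ≠ ⊤) (hB : packingPreLim R g t (ε / 2) B ≠ ⊤) :
    packingPreLim (X := fun k => X k × Y k) (prodMaps T R) (sumPotential f g)
      ((s + η) + (t + η) + η) ε (A ×ˢ B) ≠ ⊤ := by
  obtain ⟨N₁, hN₁, h₁⟩ := exists_packingPre_ne_top hA
  obtain ⟨N₂, hN₂, h₂⟩ := exists_packingPre_ne_top hB
  set N := max N₁ N₂
  refine packingPreLim_ne_top (N := N) (lt_max_of_lt_left hN₁) (ne_top_of_le_ne_top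
    (b := (∑' n : ℕ, ENNReal.ofReal (Real.exp (-(n : ℝ) * η))) *
      (packingPre T f s (ε / 2) N A * packingPre R g t (ε / 2) N B)) ?_ ?_)
  · exact ENNReal.mul_ne_top (tsum_ofReal_exp_neg_mul_ne_top hη) (ENNReal.mul_ne_top
      (ne_top_of_le_ne_top h₁ (packingPre_mono le_rfl le_rfl (le_max_left _ _)))
      (ne_top_of_le_ne_top h₂ (packingPre_mono le_rfl le_rfl (le_max_right _ _))))
  refine iSup₂_le fun C hC => ?_
  rw [← ENNReal.tsum_mul_right]
  let w : (X 0 × Y 0) × ℕ → ℝ≥0∞ := weight (X := fun k => X k × Y k) (prodMaps T R)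
    (sumPotential f g) ((s + η) + (t + η))
  let w' : (X 0 × Y 0) × ℕ → ℝ≥0∞ := weight (X := fun k => X k × Y k) (prodMaps T R)
    (sumPotential f g) ((s + η) + (t + η) + η)
  have hcover : C = ⋃ n, {p ∈ C | p.2 = n} := by
    ext p
    simp
  change ∑' p : C, w' p ≤ _
  calc ∑' p : C, w' p = ∑' p : ⋃ n, {p ∈ C | p.2 = n}, w' p := tsum_congr_set_coe w' hcover
    _ ≤ ∑' n, ∑' p : {p ∈ C | p.2 = n}, w' p := ENNReal.tsum_iUnion_le_tsum w' _
    _ ≤ _ := by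
      refine ENNReal.tsum_le_tsum fun n => ?_
      rcases lt_or_ge n N with hn | hn
      · have : IsEmpty ↥{p ∈ C | p.2 = n} :=
          ⟨fun p => (hC.le_length p p.2.1).not_gt (p.2.2.symm ▸ hn)⟩
        simp
      have hCn : IsPacking (X := fun k => X k × Y k) (prodMaps T R) (A ×ˢ B) N ε
          {p ∈ C | p.2 = n} :=
        ⟨hC.countable.mono (Set.sep_subset _ _), fun p hp => hC.centre_mem p hp.1,
          fun p hp => hC.le_length p hp.1, hC.disjoint.subset (Set.sep_subset _ _)⟩
      have hw : ∀ p : {p ∈ C | p.2 = n}, w' p = ENNReal.ofReal (Real.exp (-(n : ℝ) * η)) * w p := by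
        rintro ⟨p, hp, rfl⟩
        exact weight_add (X := fun k => X k × Y k) _ _ _
      simp only [hw, ENNReal.tsum_mul_left]
      gcongr
      exact tsum_weight_prod_le_of_length_eq hf hg hε hεδ hn hCn (fun p hp => hp.2) s t

theorem packingPressure_prod_le [CompactSpace (X 0)] [CompactSpace (Y 0)]
    (hf : EquicontinuousPotential f) (hg : EquicontinuousPotential g)
    (Z : Set (X 0)) (W : Set (Y 0))
    (h : SumDefined (packingPressure T f Z) (packingPressure R g W)) :
    packingPressure (X := fun k => X k × Y k) (prodMaps T R) (sumPotential f g) (Z ×ˢ W) ≤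
      packingPressure T f Z + packingPressure R g W := by
  obtain ⟨h₁, h₂⟩ := h
  refine EReal.le_add_of_forall_gt (by tauto) (by tauto) fun a ha b hb => ?_
  obtain ⟨s, hs, hsa⟩ := EReal.lt_iff_exists_real_btwn.1 ha
  obtain ⟨s', hs', hsa'⟩ := EReal.lt_iff_exists_real_btwn.1 hsa
  obtain ⟨t, ht, htb⟩ := EReal.lt_iff_exists_real_btwn.1 hb
  -- `s' + t` leaves room for the four losses of `η`.
  have hss : s < s' := EReal.coe_lt_coe_iff.1 hs'
  obtain ⟨η, hη, hηs⟩ : ∃ η > 0, (s + η) + (t + η) + η + η = s' + t :=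
    ⟨(s' - s) / 4, by linarith, by ring⟩
  obtain ⟨δ₁, hδ₁, hf⟩ := hf η hη
  obtain ⟨δ₂, hδ₂, hg⟩ := hg η hη
  refine le_trans ?_ (add_le_add hsa'.le htb.le)
  rw [packingPressure]
  refine iSup₂_le fun ε₀ hε₀ => ?_
  rw [← EReal.coe_add]
  -- It suffices to treat scales below the modulus of equicontinuity.
  set ε := min ε₀ (min δ₁ δ₂ / 2)
  have hδ : 0 < min δ₁ δ₂ := lt_min hδ₁ hδ₂
  have hε : 0 < ε := lt_min hε₀ (half_pos hδ)
  have hεδ : ε < min δ₁ δ₂ := (min_le_right _ _).trans_lt (half_lt_self hδ)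
  suffices h0 : packingMeasure (X := fun k => X k × Y k) (prodMaps T R) (sumPotential f g)
      (s' + t) ε (Z ×ˢ W) = 0 by
    rw [packingPressureAt]
    refine iInf₂_le_of_le (s' + t) (le_antisymm (le_trans ?_ h0.le) zero_le) le_rfl
    exact packingMeasure_mono (X := fun k => X k × Y k) le_rfl (min_le_left _ _)
  rw [← hηs]
  obtain ⟨A, hZA, hA⟩ := exists_cover_packingPreLim_ne_top
    (packingMeasure_eq_zero_of_pressure_lt (half_pos hε) hs)
  obtain ⟨B, hWB, hB⟩ := exists_cover_packingPreLim_ne_top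
    (packingMeasure_eq_zero_of_pressure_lt (half_pos hε) ht)
  refine packingMeasure_eq_zero (X := fun k => X k × Y k) (fun i : ℕ × ℕ => A i.1 ×ˢ B i.2) ?_ ?_
  · rintro ⟨x, y⟩ ⟨hx, hy⟩
    obtain ⟨i, hi⟩ := Set.mem_iUnion.1 (hZA hx)
    obtain ⟨j, hj⟩ := Set.mem_iUnion.1 (hWB hy)
    exact Set.mem_iUnion.2 ⟨(i, j), hi, hj⟩
  · exact fun i => packingPreLim_eq_zero (X := fun k => X k × Y k) hη
      (packingPreLim_prod_ne_top hη
        (fun k x y hxy => hf k x y (hxy.trans_le (min_le_left _ _)))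
        (fun k x y hxy => hg k x y (hxy.trans_le (min_le_right _ _))) hε hεδ (hA i.1) (hB i.2))

/-! ### The lower bound -/

/-- If all slices of `E` over `B` have Bowen sums at least `c`, then a packing of `B` lifts to a
packing of `E` with the same lengths, whose sum is at least `c` times as large. -/
lemma mul_packingPre_le [CompactSpace (X 0)] {s t ε : ℝ} (hε : 0 < ε)
    {E : Set (X 0 × Y 0)} {B : Set (Y 0)} {N n : ℕ} (hN : N ≤ n) {c : ℝ≥0∞}
    (hc : ∀ y ∈ B, c ≤ bowenPre T f s (3 * ε) N {x | (x, y) ∈ E}) :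
    c * packingPre R g t ε n B ≤
      packingPre (X := fun k => X k × Y k) (prodMaps T R) (sumPotential f g) (s + t) ε n E := by
  simp only [packingPre, ENNReal.mul_iSup]
  refine iSup₂_le fun C hC => ?_
  choose F hFE hFc hFd hF using fun p : Y 0 × ℕ =>
    exists_maximal_packing T {x | (x, p.1) ∈ E} p.2 hε
  let φ : (Σ p : C, F p) → (X 0 × Y 0) × ℕ := fun q => ((q.2, q.1.1.1), q.1.1.2)
  have hφ : Function.Injective φ := by
    rintro ⟨⟨⟨y, m⟩, hp⟩, ⟨x, hx⟩⟩ ⟨⟨⟨y', m'⟩, hp'⟩, ⟨x', hx'⟩⟩ h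
    simp only [φ, Prod.mk.injEq] at h
    obtain ⟨⟨rfl, rfl⟩, rfl⟩ := h
    rfl
  have : Countable C := hC.countable.to_subtype
  have : ∀ p : C, Countable (F p) := fun p => (hFc p).to_subtype
  refine le_iSup₂_of_le (Set.range φ) ⟨Set.countable_range φ, ?_, ?_, ?_⟩ ?_
  · rintro _ ⟨⟨p, x⟩, rfl⟩
    exact hFE p x.2
  · rintro _ ⟨⟨p, x⟩, rfl⟩
    exact hC.le_length p p.2
  · rintro _ ⟨⟨p, x⟩, rfl⟩ _ ⟨⟨p', x'⟩, rfl⟩ hne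
    simp only [Function.onFun, closedBowenBall_prodMaps, Set.disjoint_prod, φ]
    by_cases hp : p = p'
    · subst hp
      refine Or.inl (hFd p x.2 x'.2 fun hx => hne ?_)
      rw [Subtype.ext hx]
    · exact Or.inr (hC.disjoint p.2 p'.2 fun h => hp (Subtype.ext h))
  · rw [tsum_range _ hφ, ENNReal.tsum_sigma', ← ENNReal.tsum_mul_left]
    refine ENNReal.tsum_le_tsum fun p => ?_
    simp only [φ, weight_prodMaps, ENNReal.tsum_mul_right]
    gcongr
    refine (hc _ (hC.centre_mem p p.2)).trans
      (bowenPre_le_tsum (hFc p) (hN.trans (hC.le_length p p.2)) (fun x hx => ?_) s)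
    obtain ⟨e, he, hxe⟩ := hF p x hx
    exact ⟨e, he, fun j hj => Metric.mem_ball.2 ((hxe j hj).trans_lt (by linarith))⟩

lemma packingMeasure_eq_zero_of_prod [CompactSpace (X 0)] {s t η ε : ℝ} (hη : 0 < η) (hε : 0 < ε)
    {Z : Set (X 0)} {W : Set (Y 0)} (hZ : bowenMeasure T f s (3 * ε) Z ≠ 0)
    (h : packingMeasure (X := fun k => X k × Y k) (prodMaps T R) (sumPotential f g) (s + t) ε
      (Z ×ˢ W) = 0) :
    packingMeasure R g (t + η) ε W = 0 := by
  obtain ⟨E, hE, hfin⟩ := exists_cover_packingPreLim_ne_top (X := fun k => X k × Y k) h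
  refine packingMeasure_eq_zero (ι := ℕ × ℕ × ℕ)
    (fun i => {y | ((i.2.2 : ℝ≥0∞) + 1)⁻¹ ≤ bowenPre T f s (3 * ε) i.2.1 {x | (x, y) ∈ E i.1}})
    (fun y hy => ?_) fun i => packingPreLim_eq_zero hη ?_
  · obtain ⟨i, hi⟩ : ∃ i, bowenMeasure T f s (3 * ε) {x | (x, y) ∈ E i} ≠ 0 := by
      by_contra! hc
      refine hZ (bowenMeasure_eq_zero_of_subset_iUnion (fun x hx => ?_) hc)
      obtain ⟨i, hi⟩ := Set.mem_iUnion.1 (hE ⟨hx, hy⟩ : (x, y) ∈ ⋃ i, E i)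
      exact Set.mem_iUnion.2 ⟨i, hi⟩
    obtain ⟨N, hN⟩ : ∃ N, bowenPre T f s (3 * ε) N {x | (x, y) ∈ E i} ≠ 0 := by
      by_contra! hc
      exact hi (by simp [bowenMeasure, hc])
    obtain ⟨k, hk⟩ := ENNReal.exists_inv_nat_lt hN
    refine Set.mem_iUnion.2 ⟨(i, N, k), ?_⟩
    exact (ENNReal.inv_le_inv.2 le_self_add).trans hk.le
  · obtain ⟨i, N, k⟩ := i
    obtain ⟨n, hn, hfn⟩ := exists_packingPre_ne_top (X := fun k => X k × Y k) (hfin i)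
    refine packingPreLim_ne_top (N := max n N) (lt_max_of_lt_left hn) fun htop => ?_
    refine ne_top_of_le_ne_top hfn ((packingPre_mono (X := fun k => X k × Y k) le_rfl le_rfl
      (le_max_left n N))) (top_le_iff.1 ?_)
    refine le_trans (le_of_eq ?_) (mul_packingPre_le (R := R) (g := g) (t := t)
      (B := {y | ((k : ℝ≥0∞) + 1)⁻¹ ≤ bowenPre T f s (3 * ε) N {x | (x, y) ∈ E i}})
      hε (le_max_right n N) (fun y hy => hy))
    rw [htop, ENNReal.mul_top]
    exact ENNReal.inv_ne_zero.2 (by simp)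

theorem bowenPressure_add_packingPressure_le [CompactSpace (X 0)]
    (Z : Set (X 0)) (W : Set (Y 0)) :
    bowenPressure T f Z + packingPressure R g W ≤
      packingPressure (X := fun k => X k × Y k) (prodMaps T R) (sumPotential f g) (Z ×ˢ W) := by
  refine EReal.add_le_of_forall_lt fun a ha b hb => ?_
  obtain ⟨s, has, hs⟩ := EReal.lt_iff_exists_real_btwn.1 ha
  obtain ⟨t, hbt, ht⟩ := EReal.lt_iff_exists_real_btwn.1 hb
  obtain ⟨t', htt, ht'⟩ := EReal.lt_iff_exists_real_btwn.1 ht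
  obtain ⟨ε₁, hε₁, h₁⟩ := exists_bowenMeasure_ne_zero hs
  obtain ⟨ε₂, hε₂, h₂⟩ := exists_packingMeasure_ne_zero ht'
  set ε := min (ε₁ / 3) ε₂
  have hε : 0 < ε := lt_min (by linarith) hε₂
  have h3 : 3 * ε ≤ ε₁ := by linarith [min_le_left (ε₁ / 3) ε₂]
  refine (add_le_add has.le hbt.le).trans (le_iSup₂_of_le ε hε (le_iInf₂ fun u hu => ?_))
  rw [← EReal.coe_add, EReal.coe_le_coe_iff]
  by_contra! hlt
  have h0 := packingMeasure_eq_zero_of_prod (η := t' - t) (sub_pos.2 (EReal.coe_lt_coe_iff.1 htt))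
    hε (fun h => h₁ (le_antisymm ((bowenMeasure_anti h3).trans h.le) zero_le))
    (le_antisymm ((packingMeasure_mono (X := fun k => X k × Y k) hlt.le le_rfl).trans hu.le)
      zero_le)
  rw [add_sub_cancel] at h0
  exact h₂ (le_antisymm ((packingMeasure_mono le_rfl (min_le_right _ _)).trans h0.le) zero_le)

end Product

end NDS

theorem theorem6p2 {X Y : ℕ → Type*}
    [∀ k, MetricSpace (X k)] [∀ k, CompactSpace (X k)]
    [∀ k, MetricSpace (Y k)] [∀ k, CompactSpace (Y k)]
    (T : ∀ k, C(X k, X (k + 1))) (R : ∀ k, C(Y k, Y (k + 1)))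
    (f : ∀ k, C(X k, ℝ)) (g : ∀ k, C(Y k, ℝ))
    (hf : NDS.EquicontinuousPotential f) (hg : NDS.EquicontinuousPotential g)
    (Z : Set (X 0)) (W : Set (Y 0)) :
    (NDS.SumDefined (NDS.bowenPressure T f Z) (NDS.packingPressure R g W) →
      NDS.bowenPressure T f Z + NDS.packingPressure R g W ≤
        NDS.packingPressure (X := fun k => X k × Y k)
          (NDS.prodMaps T R) (NDS.sumPotential f g) (Z ×ˢ W)) ∧
    (NDS.SumDefined (NDS.packingPressure T f Z) (NDS.packingPressure R g W) →
      NDS.packingPressure (X := fun k => X k × Y k)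
          (NDS.prodMaps T R) (NDS.sumPotential f g) (Z ×ˢ W) ≤
        NDS.packingPressure T f Z + NDS.packingPressure R g W) := by
  exact ⟨fun _ => NDS.bowenPressure_add_packingPressure_le Z W,
    fun h => NDS.packingPressure_prod_le hf hg Z W h⟩
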